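/- Let $\mathbf p=\{p_k;k\ge 1\}$ be a probability distribution on a countably infinite alphabet ($p_k\ge 0$, $\sum_{k\ge1}p_k=1$). For $v\ge 1$ let $$\zeta_v=\sum_{k\ge 1}p_k(1-p_k)^v,\qquad \tau_v=v\,\zeta_v .$$ The quantity $\tau_v$ is called the tail index. For real sequences $f,g$ write $f(v)\asymp g(v)$ if there are constants $c_1,c_2>0$ with $c_1g(v)\le f(v)\le c_2g(v)$ for all sufficiently large $v$. 1. (Power tail) If there are $\lambda>1$, $c>0$ and an integer $k_0\ge 1$ with $p_k=c\,k^{-\lambda}$ for all $k\ge k_0$, then $\tau_v\to\infty$ as $v\to\infty$ and $\tau_v\asymp v^{1/\lambda}$. 2. (Sub-exponential tail) If there are $\lambda>0$, $\alpha\in(0,1)$, $c>0$ and an integer $k_0\ge 1$ with $p_k=c\,e^{-\lambda k^{\alpha}}$ for all $k\ge k_0$, then $\tau_v\to\infty$ as $v\to\infty$ and $\tau_v\asymp(\ln v)^{1/\alpha-1}$. 3. (Near-exponential tail) If there are $\lambda>0$, $\beta>0$, $c>0$ and an integer $k_0\ge 2$ with $p_k=c\,e^{-\lambda k/(\ln k)^{\beta}}$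 for all $k\ge k_0$, then $\tau_v\to\infty$ as $v\to\infty$ and $\tau_v\asymp(\ln\ln v)^{\beta}$. In each case the constants $c_1,c_2$ may depend on $\mathbf p$. -/

import Mathlib

open Filter

/-- `p = {p_k ; k ≥ 1}` is a probability distribution on a countably infinite alphabet,
indexed by the positive integers. -/
def IsProbDist (p : ℕ+ → ℝ) : Prop :=
  (∀ k, 0 ≤ p k) ∧ HasSum p 1

/-- The entropic moment `ζ_v = ∑_{k ≥ 1} p_k (1 - p_k)^v`. The series converges for every
probability distribution `p`, being dominated termwise by `∑ p_k`. -/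
noncomputable def entropicMoment (p : ℕ+ → ℝ) (v : ℕ) : ℝ :=
  ∑' k : ℕ+, p k * (1 - p k) ^ v

/-- The tail index `τ_v = v ζ_v`. -/
noncomputable def tailIndex (p : ℕ+ → ℝ) (v : ℕ) : ℝ :=
  (v : ℝ) * entropicMoment p v

/-- `p_k ∝ f(k)` for `k ≥ k₀`, with a positive constant of proportionality. -/
def TailProportional (p : ℕ+ → ℝ) (f : ℝ → ℝ) (k₀ : ℕ+) : Prop :=
  ∃ c : ℝ, 0 < c ∧ ∀ k : ℕ+, k₀ ≤ k → p k = c * f ((k : ℕ) : ℝ)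

/-- Power tail: `p_k ∝ k^(-lam)` for `k ≥ k₀`, some `k₀ ≥ 1`. -/
def HasPowerTail (p : ℕ+ → ℝ) (lam : ℝ) : Prop :=
  ∃ k₀ : ℕ+, TailProportional p (fun x => 1 / x ^ lam) k₀

/-- Sub-exponential tail: `p_k ∝ exp (-lam k^α)` for `k ≥ k₀`, some `k₀ ≥ 1`. -/
def HasSubexpTail (p : ℕ+ → ℝ) (lam α : ℝ) : Prop :=
  ∃ k₀ : ℕ+, TailProportional p (fun x => Real.exp (-(lam * x ^ α))) k₀

/-- Near-exponential tail: `p_k ∝ exp (-lam k / (ln k)^β)` for `k ≥ k₀`, some `k₀ ≥ 2`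
(the expression is undefined at `k = 1`, where `ln k = 0`; increasing `k₀` only weakens the
condition, so nothing is lost). -/
def HasNearExpTail (p : ℕ+ → ℝ) (lam β : ℝ) : Prop :=
  ∃ k₀ : ℕ+, 2 ≤ k₀ ∧
    TailProportional p (fun x => Real.exp (-(lam * x / Real.log x ^ β))) k₀

/-- `f ≍ g`: there are positive constants with `c₁ g(n) ≤ f(n) ≤ c₂ g(n)` for all
sufficiently large `n`. -/
def SameRate (f g : ℕ → ℝ) : Prop :=
  ∃ c₁ c₂ : ℝ, 0 < c₁ ∧ 0 < c₂ ∧ ∀ᶠ n in atTop, c₁ * g n ≤ f n ∧ f n ≤ c₂ * g n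

/-!
Write `p k = c * exp (-G k)`. In terms of `t = G k - log v`, the summand `v * p k * (1 - p k) ^ v`
is a bump: at most a constant times `exp (-|t|)`, and bounded below while `t` stays in a fixed
window to the right of `log (2 * c)`, where `v * p k ≤ 1 / 2`. So `τ_v` essentially counts the `k`
with `G k = log v + O(1)`, and there are about `1 / G'` of them, that is `r (log v)` if `G'` is
comparable to `1 / (r ∘ G)`. Away from the window the density of letters grows by at most
`exp (θ * |t|)`, with `θ < 1` by Potter's bound for `r`, which `exp (-|t|)` absorbs: what is left is
dominated by `dt / (1 + t ^ 2)`, a finite measure whose primitive `arctan` telescopes.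
-/

theorem one_add_rpow_le_mul_exp {s δ x : ℝ} (hs : 0 < s) (hδ : 0 < δ) (hx : 0 ≤ x) :
    (1 + x) ^ s ≤ (1 + s / δ) ^ s * Real.exp (δ * x) := by
  have hbase : 1 + x ≤ (1 + s / δ) * Real.exp (δ * x / s) := by
    calc 1 + x ≤ 1 + x + (δ * x / s + s / δ) := le_add_of_nonneg_right (by positivity)
      _ = (1 + s / δ) * (δ * x / s + 1) := by field_simp; ring
      _ ≤ _ := by gcongr; exact Real.add_one_le_exp _
  calc (1 + x) ^ s ≤ ((1 + s / δ) * Real.exp (δ * x / s)) ^ s := by gcongr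
    _ = _ := by
      rw [Real.mul_rpow (by positivity) (by positivity), ← Real.exp_mul, div_mul_cancel₀ _ hs.ne']

theorem one_add_sq_le_mul_exp_abs {δ : ℝ} (hδ : 0 < δ) (t : ℝ) :
    1 + t ^ 2 ≤ (1 + 2 / δ) ^ 2 * Real.exp (δ * |t|) := by
  have := one_add_rpow_le_mul_exp two_pos hδ (abs_nonneg t)
  rw [Real.rpow_two, Real.rpow_two] at this
  nlinarith [sq_abs t, abs_nonneg t]

theorem sub_div_one_add_sq_le_arctan_sub {a b D : ℝ} (hab : a ≤ b) (hD : b ≤ a + D) :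
    (b - a) / (1 + a ^ 2) ≤ 2 * (1 + D ^ 2) * (Real.arctan b - Real.arctan a) := by
  rcases hab.eq_or_lt with rfl | hlt
  · simp
  obtain ⟨ξ, hξ, hslope⟩ := exists_hasDerivAt_eq_slope Real.arctan (fun x => 1 / (1 + x ^ 2)) hlt
    Real.continuous_arctan.continuousOn (fun x _ => Real.hasDerivAt_arctan x)
  have hba : 0 < b - a := sub_pos.2 hlt
  have hξD : 1 + ξ ^ 2 ≤ 2 * (1 + D ^ 2) * (1 + a ^ 2) := by
    have : (ξ - a) ^ 2 ≤ D ^ 2 := pow_le_pow_left₀ (by linarith [hξ.1]) (by linarith [hξ.2]) 2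
    nlinarith [sq_nonneg (a - (ξ - a)), sq_nonneg (D * a)]
  rw [eq_div_iff hba.ne'] at hslope
  rw [← hslope, div_le_iff₀ (by positivity)]
  calc b - a = 1 / (1 + ξ ^ 2) * (b - a) * (1 + ξ ^ 2) := by field_simp
    _ ≤ 1 / (1 + ξ ^ 2) * (b - a) * (2 * (1 + D ^ 2) * (1 + a ^ 2)) := by gcongr
    _ = _ := by ring

theorem sum_exp_neg_abs_le {d : ℕ → ℝ} {B M θ : ℝ} (hM : 0 ≤ M) (hθ : θ < 1)
    (hgap : ∀ k, d (k + 1) - d k ≤ B)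
    (hdense : ∀ k, 1 ≤ M * Real.exp (θ * |d k|) * (d (k + 1) - d k)) (N : ℕ) :
    ∑ k ∈ Finset.range N, Real.exp (-|d k|) ≤
      (1 + 2 / (1 - θ)) ^ 2 * (2 * (1 + B ^ 2)) * Real.pi * M := by
  set C := (1 + 2 / (1 - θ)) ^ 2
  have hmono : ∀ k, 0 ≤ d (k + 1) - d k := fun k =>
    (pos_of_mul_pos_right (one_pos.trans_le (hdense k)) (by positivity)).le
  have hkernel : ∀ k, Real.exp (-|d k|) ≤ C * M * ((d (k + 1) - d k) / (1 + d k ^ 2)) := by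
    intro k
    rw [mul_div_assoc', le_div_iff₀ (by positivity)]
    calc Real.exp (-|d k|) * (1 + d k ^ 2)
        ≤ Real.exp (-|d k|) * (C * Real.exp ((1 - θ) * |d k|)) *
            (M * Real.exp (θ * |d k|) * (d (k + 1) - d k)) :=
          (mul_le_mul_of_nonneg_left (one_add_sq_le_mul_exp_abs (sub_pos.2 hθ) _)
            (Real.exp_pos _).le).trans
            (le_mul_of_one_le_right (by positivity) (hdense k))
      _ = C * M * (d (k + 1) - d k) *
            Real.exp (-|d k| + (1 - θ) * |d k| + θ * |d k|) := by
          rw [Real.exp_add, Real.exp_add]; ring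
      _ = C * M * (d (k + 1) - d k) := by ring_nf; simp
  calc ∑ k ∈ Finset.range N, Real.exp (-|d k|)
      ≤ ∑ k ∈ Finset.range N,
          C * M * (2 * (1 + B ^ 2) * (Real.arctan (d (k + 1)) - Real.arctan (d k))) :=
        Finset.sum_le_sum fun k _ => (hkernel k).trans <| by
          gcongr
          exact sub_div_one_add_sq_le_arctan_sub (sub_nonneg.1 (hmono k))
            (sub_le_iff_le_add'.1 (hgap k))
    _ = C * M * (2 * (1 + B ^ 2)) * (Real.arctan (d N) - Real.arctan (d 0)) := by
        simp only [← mul_assoc, ← Finset.mul_sum, Finset.sum_range_sub fun k => Real.arctan (d k)]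
    _ ≤ C * M * (2 * (1 + B ^ 2)) * Real.pi := by
        gcongr
        linarith [Real.arctan_lt_pi_div_two (d N), Real.neg_pi_div_two_lt_arctan (d 0)]
    _ = _ := by ring

theorem mul_sub_le_sum_of_gap {d f : ℕ → ℝ} {B E F c : ℝ} {N : ℕ} (hc : 0 ≤ c)
    (hgap : ∀ k, d (k + 1) - d k ≤ B) (hf : ∀ k, 0 ≤ f k)
    (hwindow : ∀ k, E ≤ d k → d k ≤ F → c * (d (k + 1) - d k) ≤ f k)
    (h0 : d 0 ≤ E + B) (hN : F ≤ d N) :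
    c * (F - (E + B)) ≤ ∑ k ∈ Finset.range N, f k := by
  -- Telescope the truncation of `d` to `[E + B, F]`: it moves only while `d` is in `[E, F]`.
  set φ : ℝ → ℝ := fun t => max (E + B) (min t F)
  have hstep : ∀ k, c * (φ (d (k + 1)) - φ (d k)) ≤ f k := by
    intro k
    have hzero : φ (d (k + 1)) ≤ φ (d k) → c * (φ (d (k + 1)) - φ (d k)) ≤ f k := fun h =>
      (mul_nonpos_of_nonneg_of_nonpos hc (sub_nonpos.2 h)).trans (hf k)
    rcases lt_or_ge (d k) E with hE | hE
    · exact hzero (max_le_max_left _ (min_le_left _ _) |>.trans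
        (max_le (le_max_left _ _) (by linarith [hgap k, le_max_left (E + B) (min (d k) F)])))
    rcases lt_or_ge F (d k) with hF | hF
    · refine hzero (max_le_max_left _ ?_)
      rw [min_eq_right hF.le]
      exact min_le_right _ _
    rcases le_total (d (k + 1)) (d k) with hle | hle
    · exact hzero (max_le_max_left _ (min_le_min_right _ hle))
    · refine (mul_le_mul_of_nonneg_left ?_ hc).trans (hwindow k hE hF)
      grind
  calc c * (F - (E + B)) ≤ c * (φ (d N) - φ (d 0)) := by
        gcongr
        · exact (le_max_right _ _).trans' (le_min hN le_rfl)
        · exact max_le le_rfl ((min_le_left _ _).trans h0)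
    _ = ∑ k ∈ Finset.range N, c * (φ (d (k + 1)) - φ (d k)) := by
        rw [← Finset.mul_sum, Finset.sum_range_sub fun k => φ (d k)]
    _ ≤ _ := Finset.sum_le_sum fun k _ => hstep k

theorem IsProbDist.le_one {p : ℕ+ → ℝ} (hp : IsProbDist p) (k : ℕ+) : p k ≤ 1 :=
  le_hasSum hp.2 k fun j _ => hp.1 j

/-- The summand `v q (1 - q)^v` that a letter of probability `q` contributes to `τ_v`. -/
noncomputable def tailTerm (v : ℕ) (q : ℝ) : ℝ :=
  v * (q * (1 - q) ^ v)

section tailTerm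

variable {v : ℕ} {q : ℝ}

theorem tailTerm_nonneg (h0 : 0 ≤ q) (h1 : q ≤ 1) : 0 ≤ tailTerm v q :=
  mul_nonneg v.cast_nonneg (mul_nonneg h0 (pow_nonneg (sub_nonneg.2 h1) v))

theorem tailTerm_le_mul_exp_neg (h0 : 0 ≤ q) (h1 : q ≤ 1) :
    tailTerm v q ≤ v * q * Real.exp (-(v * q)) := by
  rw [tailTerm, ← mul_assoc, ← mul_neg, Real.exp_nat_mul]
  have := sub_nonneg.2 h1
  gcongr
  exact Real.one_sub_le_exp_neg q

theorem tailTerm_le_one (h0 : 0 ≤ q) (h1 : q ≤ 1) : tailTerm v q ≤ 1 := by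
  refine (tailTerm_le_mul_exp_neg h0 h1).trans ?_
  rw [Real.exp_neg, ← div_eq_mul_inv, div_le_one (Real.exp_pos _)]
  linarith [Real.add_one_le_exp (v * q)]

theorem mul_div_two_le_tailTerm (h0 : 0 ≤ q) (h1 : q ≤ 1) (hvq : v * q ≤ 1 / 2) :
    v * q / 2 ≤ tailTerm v q := by
  have bernoulli : 1 - v * q ≤ (1 - q) ^ v := by
    simpa [sub_eq_add_neg] using one_add_mul_le_pow (show -2 ≤ -q by linarith) v
  calc v * q / 2 = v * (q * (1 / 2)) := by ring
    _ ≤ v * (q * (1 - q) ^ v) := by gcongr; linarith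

end tailTerm

theorem mul_exp_neg_le_two_div {x : ℝ} (hx : 0 < x) : x * Real.exp (-x) ≤ 2 / x := by
  rw [Real.exp_neg, ← div_eq_mul_inv, div_le_div_iff₀ (Real.exp_pos _) hx]
  nlinarith [Real.quadratic_le_exp_of_nonneg hx.le]

theorem mul_exp_neg_mul_exp_neg_le {c : ℝ} (hc : 0 < c) (t : ℝ) :
    c * Real.exp (-t) * Real.exp (-(c * Real.exp (-t))) ≤ max c (2 / c) * Real.exp (-|t|) := by
  rcases le_total 0 t with ht | ht
  · rw [abs_of_nonneg ht]
    calc c * Real.exp (-t) * Real.exp (-(c * Real.exp (-t))) ≤ c * Real.exp (-t) :=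
          mul_le_of_le_one_right (by positivity)
            (Real.exp_le_one_iff.2 (neg_nonpos.2 (by positivity)))
      _ ≤ _ := by gcongr; exact le_max_left _ _
  · rw [abs_of_nonpos ht, neg_neg]
    calc c * Real.exp (-t) * Real.exp (-(c * Real.exp (-t))) ≤ 2 / (c * Real.exp (-t)) :=
          mul_exp_neg_le_two_div (by positivity)
      _ = 2 / c * Real.exp t := by rw [Real.exp_neg]; field_simp
      _ ≤ _ := by gcongr; exact le_max_right _ _

theorem natCast_mul_mul_exp_neg {v : ℕ} (hv : 0 < v) (c g : ℝ) :
    v * (c * Real.exp (-g)) = c * Real.exp (-(g - Real.log v)) := by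
  rw [neg_sub, sub_eq_add_neg, Real.exp_add, Real.exp_log (by exact_mod_cast hv)]
  ring

theorem tailTerm_mul_exp_neg_le {c g : ℝ} {v : ℕ} (hc : 0 < c) (hv : 0 < v)
    (h1 : c * Real.exp (-g) ≤ 1) :
    tailTerm v (c * Real.exp (-g)) ≤ max c (2 / c) * Real.exp (-|g - Real.log v|) := by
  refine (tailTerm_le_mul_exp_neg (by positivity) h1).trans ?_
  rw [natCast_mul_mul_exp_neg hv]
  exact mul_exp_neg_mul_exp_neg_le hc _

theorem le_tailTerm_mul_exp_neg {c g F : ℝ} {v : ℕ} (hc : 0 < c) (hv : 0 < v)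
    (h1 : c * Real.exp (-g) ≤ 1) (hlow : Real.log (2 * c) ≤ g - Real.log v)
    (hF : g - Real.log v ≤ F) :
    c * Real.exp (-F) / 2 ≤ tailTerm v (c * Real.exp (-g)) := by
  have hhalf : v * (c * Real.exp (-g)) ≤ 1 / 2 := by
    calc v * (c * Real.exp (-g)) = c * Real.exp (-(g - Real.log v)) :=
          natCast_mul_mul_exp_neg hv c g
      _ ≤ c * Real.exp (-Real.log (2 * c)) := by gcongr
      _ = 1 / 2 := by rw [Real.exp_neg, Real.exp_log (by positivity)]; field_simp
  refine le_trans ?_ (mul_div_two_le_tailTerm (by positivity) h1 hhalf)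
  rw [natCast_mul_mul_exp_neg hv]
  gcongr

theorem sum_tailTerm_mul_exp_neg_le {g : ℕ → ℝ} {c B M θ : ℝ} {v : ℕ} (hc : 0 < c) (hv : 0 < v)
    (h1 : ∀ k, c * Real.exp (-g k) ≤ 1) (hM : 0 ≤ M) (hθ : θ < 1)
    (hgap : ∀ k, g (k + 1) - g k ≤ B)
    (hdense : ∀ k, 1 ≤ M * Real.exp (θ * |g k - Real.log v|) * (g (k + 1) - g k)) (N : ℕ) :
    ∑ k ∈ Finset.range N, tailTerm v (c * Real.exp (-g k)) ≤
      max c (2 / c) * ((1 + 2 / (1 - θ)) ^ 2 * (2 * (1 + B ^ 2)) * Real.pi * M) := by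
  calc ∑ k ∈ Finset.range N, tailTerm v (c * Real.exp (-g k))
      ≤ ∑ k ∈ Finset.range N, max c (2 / c) * Real.exp (-|g k - Real.log v|) :=
        Finset.sum_le_sum fun k _ => tailTerm_mul_exp_neg_le hc hv (h1 k)
    _ ≤ _ := by
        rw [← Finset.mul_sum]
        gcongr
        exact sum_exp_neg_abs_le hM hθ (fun k => by simpa using hgap k)
          (fun k => by simpa using hdense k) N

theorem le_sum_tailTerm_mul_exp_neg {g : ℕ → ℝ} {c B E F M R : ℝ} {v N : ℕ} (hc : 0 < c)
    (hv : 0 < v) (h1 : ∀ k, c * Real.exp (-g k) ≤ 1) (hM : 0 < M) (hR : 0 ≤ R)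
    (hE : Real.log (2 * c) ≤ E) (hgap : ∀ k, g (k + 1) - g k ≤ B)
    (hsparse : ∀ k, g k - Real.log v ∈ Set.Icc E F → R * (g (k + 1) - g k) ≤ M)
    (h0 : g 0 - Real.log v ≤ E + B) (hN : F ≤ g N - Real.log v) :
    c * Real.exp (-F) / 2 / M * R * (F - (E + B)) ≤
      ∑ k ∈ Finset.range N, tailTerm v (c * Real.exp (-g k)) := by
  refine mul_sub_le_sum_of_gap (d := fun k => g k - Real.log v) (by positivity)
    (fun k => by simpa using hgap k) (fun k => tailTerm_nonneg (by positivity) (h1 k))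
    (fun k hEk hkF => ?_) h0 hN
  rw [sub_sub_sub_cancel_right]
  calc c * Real.exp (-F) / 2 / M * R * (g (k + 1) - g k)
      = c * Real.exp (-F) / 2 / M * (R * (g (k + 1) - g k)) := by ring
    _ ≤ c * Real.exp (-F) / 2 / M * M := by gcongr; exact hsparse k ⟨hEk, hkF⟩
    _ = c * Real.exp (-F) / 2 := div_mul_cancel₀ _ hM.ne'
    _ ≤ _ := le_tailTerm_mul_exp_neg hc hv (h1 k) (hE.trans hEk) hkF

theorem hasSum_tailIndex {p : ℕ+ → ℝ} (hp : IsProbDist p) (v : ℕ) :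
    HasSum (fun n : ℕ => tailTerm v (p n.succPNat)) (tailIndex p v) := by
  have hsummable : Summable fun k => p k * (1 - p k) ^ v :=
    .of_nonneg_of_le
      (fun k => mul_nonneg (hp.1 k) (pow_nonneg (sub_nonneg.2 (hp.le_one k)) v))
      (fun k => mul_le_of_le_one_right (hp.1 k)
        (pow_le_one₀ (sub_nonneg.2 (hp.le_one k)) (sub_le_self 1 (hp.1 k))))
      hp.2.summable
  exact (Equiv.pnatEquivNat.symm.hasSum_iff.2 hsummable.hasSum).mul_left (v : ℝ)

theorem sum_tailTerm_le_tailIndex {p : ℕ+ → ℝ} (hp : IsProbDist p) (v K N : ℕ) :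
    ∑ k ∈ Finset.range N, tailTerm v (p (K + k).succPNat) ≤ tailIndex p v := by
  have h := sum_le_hasSum ((Finset.range N).map (addLeftEmbedding K))
    (fun n _ => tailTerm_nonneg (hp.1 n.succPNat) (hp.le_one _)) (hasSum_tailIndex hp v)
  simpa only [Finset.sum_map, addLeftEmbedding_apply] using h

theorem tailIndex_le_of_sum_tailTerm_le {p : ℕ+ → ℝ} (hp : IsProbDist p) {v K : ℕ} {S : ℝ}
    (hS : ∀ N, ∑ k ∈ Finset.range N, tailTerm v (p (K + k).succPNat) ≤ S) :
    tailIndex p v ≤ K + S := by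
  refine le_of_tendsto' ((tendsto_add_atTop_iff_nat K).2 (hasSum_tailIndex hp v).tendsto_sum_nat)
    fun N => ?_
  rw [add_comm N K, Finset.sum_range_add]
  refine add_le_add ?_ (hS N)
  simpa using Finset.sum_le_card_nsmul (Finset.range K) _ 1
    fun n _ => tailTerm_le_one (v := v) (hp.1 n.succPNat) (hp.le_one _)

/-- Potter's bound of order `θ`, in logarithmic coordinates: `v ↦ r (log v)` changes by at most a
constant factor times `max (u / v) (v / u) ^ θ` between large arguments `u` and `v`. -/
def HasPotterBound (r : ℝ → ℝ) (θ : ℝ) : Prop :=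
  ∃ M > 0, ∀ᶠ z : ℝ × ℝ in atTop ×ˢ atTop, r z.1 ≤ M * r z.2 * Real.exp (θ * |z.1 - z.2|)

theorem hasPotterBound_exp_mul {θ : ℝ} (hθ : 0 ≤ θ) :
    HasPotterBound (fun y => Real.exp (θ * y)) θ := by
  refine ⟨1, one_pos, Eventually.of_forall fun z => ?_⟩
  rw [one_mul, ← Real.exp_add, Real.exp_le_exp, ← mul_add]
  gcongr
  linarith [le_abs_self (z.1 - z.2)]

theorem HasPotterBound.rpow_of_le_mul_one_add_abs_sub {f : ℝ → ℝ} {s θ : ℝ} (hs : 0 < s)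
    (hθ : 0 < θ) (hf0 : ∀ᶠ y in atTop, 0 ≤ f y)
    (hf : ∀ᶠ z : ℝ × ℝ in atTop ×ˢ atTop, f z.1 ≤ f z.2 * (1 + |z.1 - z.2|)) :
    HasPotterBound (fun y => f y ^ s) θ := by
  refine ⟨(1 + s / θ) ^ s, by positivity, ?_⟩
  filter_upwards [hf, hf0.prod_inl atTop, hf0.prod_inr atTop] with z hz h1 h2
  calc f z.1 ^ s ≤ (f z.2 * (1 + |z.1 - z.2|)) ^ s := by gcongr
    _ = f z.2 ^ s * (1 + |z.1 - z.2|) ^ s := Real.mul_rpow h2 (by positivity)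
    _ ≤ f z.2 ^ s * ((1 + s / θ) ^ s * Real.exp (θ * |z.1 - z.2|)) := by
        gcongr
        exact one_add_rpow_le_mul_exp hs hθ (abs_nonneg _)
    _ = _ := by ring

theorem le_mul_one_add_abs_sub {y z : ℝ} (hz : 1 ≤ z) : y ≤ z * (1 + |y - z|) := by
  nlinarith [le_abs_self (y - z), mul_nonneg (sub_nonneg.2 hz) (abs_nonneg (y - z))]

theorem hasPotterBound_rpow {s θ : ℝ} (hs : 0 < s) (hθ : 0 < θ) :
    HasPotterBound (fun y => y ^ s) θ :=
  .rpow_of_le_mul_one_add_abs_sub hs hθ (eventually_ge_atTop 0) <|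
    ((eventually_ge_atTop 1).prod_inr atTop).mono fun _ => le_mul_one_add_abs_sub

theorem log_le_log_mul_one_add_abs_sub {y z : ℝ} (hy : 0 < y) (hz : Real.exp 1 ≤ z) :
    Real.log y ≤ Real.log z * (1 + |y - z|) := by
  have hz0 : 0 < z := (Real.exp_pos 1).trans_le hz
  have hlog : 1 ≤ Real.log z := (Real.le_log_iff_exp_le hz0).2 hz
  have hyz : y ≤ z * (1 + |y - z|) :=
    le_mul_one_add_abs_sub (by linarith [Real.add_one_le_exp (1 : ℝ)])
  calc Real.log y ≤ Real.log z + Real.log (1 + |y - z|) := by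
        rw [← Real.log_mul hz0.ne' (by positivity)]
        gcongr
    _ ≤ Real.log z + |y - z| := by
        linarith [Real.log_le_sub_one_of_pos (show 0 < 1 + |y - z| by positivity)]
    _ ≤ _ := by nlinarith [abs_nonneg (y - z)]

theorem hasPotterBound_log_rpow {s θ : ℝ} (hs : 0 < s) (hθ : 0 < θ) :
    HasPotterBound (fun y => Real.log y ^ s) θ := by
  refine .rpow_of_le_mul_one_add_abs_sub hs hθ
    (Real.tendsto_log_atTop.eventually_ge_atTop 0) ?_
  filter_upwards [(eventually_gt_atTop 0).prod_inl atTop,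
    (eventually_ge_atTop (Real.exp 1)).prod_inr atTop] with z hy hz
  exact log_le_log_mul_one_add_abs_sub hy hz

theorem abs_sub_le_of_mem_Icc {a b y z D : ℝ} (hy : y ∈ Set.Icc a b) (hD : b - a ≤ D) :
    |y - z| ≤ |a - z| + D := by
  have : |y - a| ≤ D := by rw [abs_of_nonneg (sub_nonneg.2 hy.1)]; linarith [hy.2]
  linarith [abs_sub_le y a z]

/-- The tail exponent `G` grows according to `G' ≍ 1 / (r ∘ G)`, so that about `r y` integers `k`
have `G k` within a bounded distance of `y`. For `p_k = c * exp (-G k)` this makes `r (log v)`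
the rate of `τ_v`. -/
structure HasExponentRate (G r : ℝ → ℝ) : Prop where
  tendsto_exponent : Tendsto G atTop atTop
  tendsto_rate : Tendsto r atTop atTop
  potter : ∃ θ, 0 ≤ θ ∧ θ < 1 ∧ HasPotterBound r θ
  growth : ∃ A B, 0 < A ∧
    ∀ᶠ x in atTop, DifferentiableAt ℝ G x ∧ r (G x) * deriv G x ∈ Set.Icc A B

namespace HasExponentRate

variable {G r : ℝ → ℝ}

theorem of_tendsto {G' : ℝ → ℝ} {θ l : ℝ} (hG : Tendsto G atTop atTop)
    (hr : Tendsto r atTop atTop) (hθ0 : 0 ≤ θ) (hθ1 : θ < 1) (hpotter : HasPotterBound r θ)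
    (hG' : ∀ᶠ x in atTop, HasDerivAt G (G' x) x) (hl : 0 < l)
    (hlim : Tendsto (fun x => r (G x) * G' x) atTop (nhds l)) : HasExponentRate G r where
  tendsto_exponent := hG
  tendsto_rate := hr
  potter := ⟨θ, hθ0, hθ1, hpotter⟩
  growth := by
    refine ⟨l / 2, 2 * l, half_pos hl, ?_⟩
    filter_upwards [hG', hlim.eventually (Icc_mem_nhds (half_lt_self hl)
      (lt_two_mul_self hl))] with x hx hmem
    exact ⟨hx.differentiableAt, by rwa [hx.deriv]⟩

theorem exists_rate_mul_gap_mem_Icc (h : HasExponentRate G r) :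
    ∃ A B, 0 < A ∧ ∀ᶠ x in atTop, ∃ y ∈ Set.Icc (G x) (G (x + 1)),
      r y * (G (x + 1) - G x) ∈ Set.Icc A B := by
  obtain ⟨A, B, hA, hgrowth⟩ := h.growth
  refine ⟨A, B, hA, ?_⟩
  obtain ⟨a, ha⟩ := eventually_atTop.1
    (hgrowth.and (h.tendsto_exponent.eventually (h.tendsto_rate.eventually_gt_atTop 0)))
  have hmono : MonotoneOn G (Set.Ici a) := by
    refine monotoneOn_of_deriv_nonneg (convex_Ici a)
      (fun x hx => (ha x hx).1.1.continuousAt.continuousWithinAt) ?_ ?_ <;>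
      rw [interior_Ici] <;> intro x hx <;> obtain ⟨⟨hdiff, hmem⟩, hr0⟩ := ha x hx.le
    · exact hdiff.differentiableWithinAt
    · exact (pos_of_mul_pos_right (hA.trans_le hmem.1) hr0.le).le
  filter_upwards [eventually_ge_atTop a] with x hx
  have hdiff : ∀ ξ, x ≤ ξ → DifferentiableAt ℝ G ξ := fun ξ hξ => (ha ξ (hx.trans hξ)).1.1
  obtain ⟨ξ, hξ, hslope⟩ := exists_deriv_eq_slope G (lt_add_one x)
    (fun y hy => (hdiff y hy.1).continuousAt.continuousWithinAt)
    (fun y hy => (hdiff y hy.1.le).differentiableWithinAt)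
  rw [add_sub_cancel_left, div_one] at hslope
  have haξ : a ≤ ξ := hx.trans hξ.1.le
  refine ⟨G ξ, ⟨hmono hx haξ hξ.1.le, hmono haξ (haξ.trans hξ.2.le) hξ.2.le⟩, ?_⟩
  exact hslope ▸ (ha ξ haξ).1.2

theorem exists_gap_le (h : HasExponentRate G r) :
    ∃ B, ∀ᶠ x in atTop, G (x + 1) - G x ≤ B := by
  obtain ⟨_, B, -, hgap⟩ := h.exists_rate_mul_gap_mem_Icc
  obtain ⟨a, ha⟩ := eventually_atTop.1 (h.tendsto_rate.eventually_ge_atTop 1)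
  refine ⟨B, ?_⟩
  filter_upwards [hgap, h.tendsto_exponent.eventually_ge_atTop a] with x ⟨y, hy, hmem⟩ hx
  exact (le_mul_of_one_le_left (sub_nonneg.2 (hy.1.trans hy.2)) (ha y (hx.trans hy.1))).trans
    hmem.2

theorem exists_one_le_rate_mul_gap (h : HasExponentRate G r) :
    ∃ θ < 1, ∃ M > 0, ∀ᶠ z : ℝ × ℝ in atTop ×ˢ atTop,
      1 ≤ M * r z.2 * Real.exp (θ * |G z.1 - z.2|) * (G (z.1 + 1) - G z.1) := by
  obtain ⟨θ, hθ0, hθ1, M, hM, hpotter⟩ := h.potter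
  obtain ⟨A, B, hA, hgap⟩ := h.exists_rate_mul_gap_mem_Icc
  obtain ⟨D, hD⟩ := h.exists_gap_le
  rw [prod_atTop_atTop_eq] at hpotter
  obtain ⟨a, ha⟩ := eventually_atTop_prod_self.1 hpotter
  refine ⟨θ, hθ1, M * Real.exp (θ * D) / A, by positivity, ?_⟩
  filter_upwards [(hgap.and hD).prod_inl atTop,
    (h.tendsto_exponent.eventually_ge_atTop a).prod_inl atTop,
    ((eventually_ge_atTop a).and (h.tendsto_rate.eventually_ge_atTop 0)).prod_inr atTop]
    with ⟨x, Y⟩ ⟨⟨y, hy, hmem⟩, hD⟩ hGx ⟨hY, hrY⟩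
  have hΔ : 0 ≤ G (x + 1) - G x := sub_nonneg.2 (hy.1.trans hy.2)
  have hdist : |y - Y| ≤ |G x - Y| + D := abs_sub_le_of_mem_Icc hy hD
  have hlower : A ≤ M * r Y * Real.exp (θ * (|G x - Y| + D)) * (G (x + 1) - G x) :=
    calc A ≤ r y * (G (x + 1) - G x) := hmem.1
      _ ≤ M * r Y * Real.exp (θ * |y - Y|) * (G (x + 1) - G x) := by
          gcongr
          exact ha y Y (hGx.trans hy.1) hY
      _ ≤ _ := by gcongr
  rw [mul_add, Real.exp_add] at hlower
  calc 1 ≤ M * r Y * (Real.exp (θ * |G x - Y|) * Real.exp (θ * D)) * (G (x + 1) - G x) / A :=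
        (one_le_div hA).2 hlower
    _ = _ := by ring

theorem exists_rate_mul_gap_le (h : HasExponentRate G r) (L : ℝ) :
    ∃ M > 0, ∀ᶠ z : ℝ × ℝ in atTop ×ˢ atTop,
      |G z.1 - z.2| ≤ L → r z.2 * (G (z.1 + 1) - G z.1) ≤ M := by
  obtain ⟨θ, hθ0, -, M, hM, hpotter⟩ := h.potter
  obtain ⟨A, B, hA, hgap⟩ := h.exists_rate_mul_gap_mem_Icc
  obtain ⟨D, hD⟩ := h.exists_gap_le
  have hB : 0 < B := by
    obtain ⟨_, _, _, hmem⟩ := hgap.exists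
    exact hA.trans_le (hmem.1.trans hmem.2)
  rw [prod_atTop_atTop_eq] at hpotter
  obtain ⟨a, ha⟩ := eventually_atTop_prod_self.1 hpotter
  refine ⟨M * Real.exp (θ * (L + D)) * B, by positivity, ?_⟩
  filter_upwards [(hgap.and hD).prod_inl atTop,
    (h.tendsto_exponent.eventually_ge_atTop a).prod_inl atTop,
    (eventually_ge_atTop a).prod_inr atTop] with ⟨x, Y⟩ ⟨⟨y, hy, hmem⟩, hD⟩ hGx hY hL
  have hΔ : 0 ≤ G (x + 1) - G x := sub_nonneg.2 (hy.1.trans hy.2)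
  have hdist : |Y - y| ≤ L + D := by
    rw [abs_sub_comm]
    exact (abs_sub_le_of_mem_Icc hy hD).trans (add_le_add_left hL D)
  calc r Y * (G (x + 1) - G x)
      ≤ M * r y * Real.exp (θ * |Y - y|) * (G (x + 1) - G x) := by
        gcongr
        exact ha Y y hY (hGx.trans hy.1)
    _ = M * Real.exp (θ * |Y - y|) * (r y * (G (x + 1) - G x)) := by ring
    _ ≤ M * Real.exp (θ * (L + D)) * B := by
        have := hA.le.trans hmem.1
        gcongr
        exact hmem.2

end HasExponentRate

theorem SameRate.tendsto_atTop {f g : ℕ → ℝ} (h : SameRate f g) (hg : Tendsto g atTop atTop) :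
    Tendsto f atTop atTop := by
  obtain ⟨c₁, _, hc₁, -, hfg⟩ := h
  exact tendsto_atTop_mono' _ (hfg.mono fun _ => And.left) (hg.const_mul_atTop hc₁)

theorem SameRate.congr_right {f g g' : ℕ → ℝ} (h : SameRate f g) (hg : g =ᶠ[atTop] g') :
    SameRate f g' := by
  obtain ⟨c₁, c₂, hc₁, hc₂, hfg⟩ := h
  refine ⟨c₁, c₂, hc₁, hc₂, ?_⟩
  filter_upwards [hfg, hg] with n hn hgn
  rwa [← hgn]

theorem TailProportional.exists_eventually_eq {p : ℕ+ → ℝ} {f : ℝ → ℝ} {k₀ : ℕ+}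
    (h : TailProportional p f k₀) :
    ∃ c > 0, ∀ᶠ n : ℕ in atTop, p n.succPNat = c * f (n + 1) := by
  obtain ⟨c, hc, hpc⟩ := h
  refine ⟨c, hc, ?_⟩
  filter_upwards [eventually_ge_atTop (k₀ : ℕ)] with n hn
  have hk₀ : k₀ ≤ n.succPNat := PNat.coe_le_coe _ _ |>.1 (by rw [Nat.succPNat_coe]; omega)
  simpa using hpc _ hk₀

theorem tendsto_natCast_add_one : Tendsto (fun n : ℕ => (n : ℝ) + 1) atTop atTop :=
  tendsto_atTop_add_const_right _ 1 tendsto_natCast_atTop_atTop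

theorem tendsto_log_natCast : Tendsto (fun v : ℕ => Real.log v) atTop atTop :=
  Real.tendsto_log_atTop.comp tendsto_natCast_atTop_atTop

theorem exists_forall_ge_of_eventually {P : ℕ → Prop} {Q : ℕ × ℕ → Prop}
    (hP : ∀ᶠ n in atTop, P n) (hQ : ∀ᶠ z in atTop ×ˢ atTop, Q z) :
    ∃ K, ∀ k v, K ≤ v → P (K + k) ∧ Q (K + k, v) := by
  have hPQ := (hP.prod_inl atTop).and hQ
  rw [prod_atTop_atTop_eq] at hPQ
  obtain ⟨K, hK⟩ := eventually_atTop_prod_self.1 hPQ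
  exact ⟨K, fun k v hv => hK (K + k) v (Nat.le_add_right K k) hv⟩

section TailIndex

variable {p : ℕ+ → ℝ} {G r : ℝ → ℝ} {k₀ : ℕ+}

theorem exists_tailIndex_le_rate (hp : IsProbDist p)
    (htail : TailProportional p (fun x => Real.exp (-G x)) k₀) (h : HasExponentRate G r) :
    ∃ C > 0, ∀ᶠ v : ℕ in atTop, tailIndex p v ≤ C * r (Real.log v) := by
  obtain ⟨c, hc, hpc⟩ := htail.exists_eventually_eq
  obtain ⟨B, hB⟩ := h.exists_gap_le
  obtain ⟨θ, hθ, M, hM, hdense⟩ := h.exists_one_le_rate_mul_gap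
  obtain ⟨K, hK⟩ := exists_forall_ge_of_eventually
    (hpc.and (tendsto_natCast_add_one.eventually hB))
    ((tendsto_natCast_add_one.prodMap tendsto_log_natCast).eventually hdense)
  set C := (1 + 2 / (1 - θ)) ^ 2 * (2 * (1 + B ^ 2)) * Real.pi
  refine ⟨K + max c (2 / c) * (C * M), by positivity, ?_⟩
  filter_upwards [eventually_ge_atTop K, eventually_gt_atTop 0,
    tendsto_log_natCast.eventually (h.tendsto_rate.eventually_ge_atTop 1)] with v hvK hv0 hr
  set g : ℕ → ℝ := fun k => G ((K + k : ℕ) + 1)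
  have hq : ∀ k, p (K + k).succPNat = c * Real.exp (-g k) := fun k => (hK k v hvK).1.1
  have hsum : ∀ N, ∑ k ∈ Finset.range N, tailTerm v (p (K + k).succPNat) ≤
      max c (2 / c) * (C * (M * r (Real.log v))) := by
    simp only [hq]
    refine sum_tailTerm_mul_exp_neg_le hc hv0 (fun k => hq k ▸ hp.le_one _) (by positivity) hθ
      (fun k => ?_) (fun k => ?_)
    · simpa [g, add_assoc] using (hK k v hvK).1.2
    · simpa [g, add_assoc] using (hK k v hvK).2
  calc tailIndex p v ≤ K + max c (2 / c) * (C * (M * r (Real.log v))) :=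
        tailIndex_le_of_sum_tailTerm_le hp hsum
    _ ≤ K * r (Real.log v) + max c (2 / c) * (C * (M * r (Real.log v))) := by
        gcongr
        exact le_mul_of_one_le_right K.cast_nonneg hr
    _ = _ := by ring

theorem exists_rate_le_tailIndex (hp : IsProbDist p)
    (htail : TailProportional p (fun x => Real.exp (-G x)) k₀) (h : HasExponentRate G r) :
    ∃ C > 0, ∀ᶠ v : ℕ in atTop, C * r (Real.log v) ≤ tailIndex p v := by
  obtain ⟨c, hc, hpc⟩ := htail.exists_eventually_eq
  obtain ⟨B, hB⟩ := h.exists_gap_le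
  set E := Real.log (2 * c)
  set F := E + B + 1 with hF
  obtain ⟨M, hM, hsparse⟩ := h.exists_rate_mul_gap_le (max |E| |F|)
  obtain ⟨K, hK⟩ := exists_forall_ge_of_eventually
    (hpc.and (tendsto_natCast_add_one.eventually hB))
    ((tendsto_natCast_add_one.prodMap tendsto_log_natCast).eventually hsparse)
  set g : ℕ → ℝ := fun k => G ((K + k : ℕ) + 1)
  have hg : Tendsto g atTop atTop := h.tendsto_exponent.comp <|
    tendsto_natCast_add_one.comp (tendsto_atTop_mono (Nat.le_add_left · K) tendsto_id)
  refine ⟨c * Real.exp (-F) / 2 / M, by positivity, ?_⟩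
  filter_upwards [eventually_ge_atTop K, eventually_gt_atTop 0,
    tendsto_log_natCast.eventually (h.tendsto_rate.eventually_ge_atTop 0),
    tendsto_log_natCast.eventually_ge_atTop (g 0 - (E + B))] with v hvK hv0 hr hv
  obtain ⟨N, hN⟩ := (hg.eventually_ge_atTop (F + Real.log v)).exists
  have hq : ∀ k, p (K + k).succPNat = c * Real.exp (-g k) := fun k => (hK k v hvK).1.1
  calc c * Real.exp (-F) / 2 / M * r (Real.log v)
      = c * Real.exp (-F) / 2 / M * r (Real.log v) * (F - (E + B)) := by rw [hF]; ring
    _ ≤ ∑ k ∈ Finset.range N, tailTerm v (p (K + k).succPNat) := by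
        simp only [hq]
        refine le_sum_tailTerm_mul_exp_neg hc hv0 (fun k => hq k ▸ hp.le_one _) hM hr le_rfl
          (fun k => ?_) (fun k hk => ?_) (by linarith) (by linarith)
        · simpa [g, add_assoc] using (hK k v hvK).1.2
        · simpa [g, add_assoc] using (hK k v hvK).2 (abs_le_max_abs_abs hk.1 hk.2)
    _ ≤ tailIndex p v := sum_tailTerm_le_tailIndex hp v K N

theorem sameRate_tailIndex (hp : IsProbDist p)
    (htail : TailProportional p (fun x => Real.exp (-G x)) k₀) (h : HasExponentRate G r) :
    SameRate (tailIndex p) (fun v => r (Real.log v)) := by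
  obtain ⟨c₁, hc₁, hlower⟩ := exists_rate_le_tailIndex hp htail h
  obtain ⟨c₂, hc₂, hupper⟩ := exists_tailIndex_le_rate hp htail h
  exact ⟨c₁, c₂, hc₁, hc₂, hlower.and hupper⟩

theorem tendsto_tailIndex_atTop (hp : IsProbDist p)
    (htail : TailProportional p (fun x => Real.exp (-G x)) k₀) (h : HasExponentRate G r) :
    Tendsto (tailIndex p) atTop atTop :=
  (sameRate_tailIndex hp htail h).tendsto_atTop (h.tendsto_rate.comp tendsto_log_natCast)

end TailIndex

theorem hasExponentRate_mul_log {lam : ℝ} (hlam : 1 < lam) :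
    HasExponentRate (fun x => lam * Real.log x) (fun y => Real.exp (1 / lam * y)) := by
  have hlam0 : 0 < lam := one_pos.trans hlam
  refine .of_tendsto (G' := fun x => lam * x⁻¹) (Real.tendsto_log_atTop.const_mul_atTop hlam0)
    (Real.tendsto_exp_atTop.comp (tendsto_id.const_mul_atTop (one_div_pos.2 hlam0)))
    (one_div_pos.2 hlam0).le ((div_lt_one hlam0).2 hlam)
    (hasPotterBound_exp_mul (one_div_pos.2 hlam0).le) ?_ hlam0 ?_
  · filter_upwards [eventually_ne_atTop 0] with x hx
    exact (Real.hasDerivAt_log hx).const_mul lam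
  · refine tendsto_const_nhds.congr' ?_
    filter_upwards [eventually_gt_atTop 0] with x hx
    rw [one_div, inv_mul_cancel_left₀ hlam0.ne', Real.exp_log hx]
    field_simp

theorem hasExponentRate_mul_rpow {lam α : ℝ} (hlam : 0 < lam) (hα0 : 0 < α) (hα1 : α < 1) :
    HasExponentRate (fun x => lam * x ^ α) (fun y => y ^ (1 / α - 1)) := by
  have hs : 0 < 1 / α - 1 := sub_pos.2 (one_lt_one_div hα0 hα1)
  refine .of_tendsto (G' := fun x => lam * (α * x ^ (α - 1))) (θ := 1 / 2)
    (l := lam ^ (1 / α - 1) * (lam * α)) ((tendsto_rpow_atTop hα0).const_mul_atTop hlam)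
    (tendsto_rpow_atTop hs) (by norm_num) (by norm_num)
    (hasPotterBound_rpow hs (by norm_num)) ?_ (by positivity) ?_
  · filter_upwards [eventually_ne_atTop 0] with x hx
    exact (Real.hasDerivAt_rpow_const (Or.inl hx)).const_mul lam
  · refine tendsto_const_nhds.congr' ?_
    filter_upwards [eventually_gt_atTop 0] with x hx
    have hpow : (x ^ α) ^ (1 / α - 1) * x ^ (α - 1) = 1 := by
      rw [← Real.rpow_mul hx.le, ← Real.rpow_add hx,
        show α * (1 / α - 1) + (α - 1) = 0 by field_simp; ring, Real.rpow_zero]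
    rw [Real.mul_rpow hlam.le (by positivity)]
    linear_combination -(lam ^ (1 / α - 1) * (lam * α)) * hpow

theorem hasDerivAt_mul_div_log_rpow {lam β x : ℝ} (hx : 1 < x) :
    HasDerivAt (fun x => lam * x / Real.log x ^ β)
      (lam * (1 - β / Real.log x) / Real.log x ^ β) x := by
  have hlog : 0 < Real.log x := Real.log_pos hx
  have hpow : Real.log x ^ β ≠ 0 := (Real.rpow_pos_of_pos hlog β).ne'
  have hx0 : x ≠ 0 := by linarith
  refine (((hasDerivAt_id x).const_mul lam).div
    ((Real.hasDerivAt_log hx0).rpow_const (Or.inl hlog.ne')) hpow).congr_deriv ?_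
  rw [Real.rpow_sub_one hlog.ne']
  simp only [id]
  field_simp

theorem tendsto_log_mul_div_log_rpow_div_log {lam : ℝ} (hlam : 0 < lam) (β : ℝ) :
    Tendsto (fun x => Real.log (lam * x / Real.log x ^ β) / Real.log x) atTop (nhds 1) := by
  have hconst : Tendsto (fun x => Real.log lam / Real.log x) atTop (nhds 0) :=
    Real.tendsto_log_atTop.const_div_atTop _
  have hloglog : Tendsto (fun x => Real.log (Real.log x) / Real.log x) atTop (nhds 0) :=
    Real.isLittleO_log_id_atTop.tendsto_div_nhds_zero.comp Real.tendsto_log_atTop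
  have hlim := (hconst.add_const 1).sub (hloglog.const_mul β)
  rw [mul_zero, sub_zero, zero_add] at hlim
  refine hlim.congr' ?_
  filter_upwards [eventually_gt_atTop 1] with x hx
  have hlog : 0 < Real.log x := Real.log_pos hx
  rw [Real.log_div (by positivity) (by positivity), Real.log_mul hlam.ne' (by positivity),
    Real.log_rpow hlog]
  field_simp

theorem tendsto_mul_div_log_rpow_atTop {lam : ℝ} (hlam : 0 < lam) (β : ℝ) :
    Tendsto (fun x => lam * x / Real.log x ^ β) atTop atTop := by
  have hlog : Tendsto (fun x => Real.log (lam * x / Real.log x ^ β)) atTop atTop := by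
    refine ((tendsto_log_mul_div_log_rpow_div_log hlam β).pos_mul_atTop one_pos
      Real.tendsto_log_atTop).congr' ?_
    filter_upwards [eventually_gt_atTop 1] with x hx
    exact div_mul_cancel₀ _ (Real.log_pos hx).ne'
  refine (Real.tendsto_exp_atTop.comp hlog).congr' ?_
  filter_upwards [eventually_gt_atTop 1] with x hx
  have := Real.log_pos hx
  exact Real.exp_log (by positivity)

theorem hasExponentRate_mul_div_log_rpow {lam β : ℝ} (hlam : 0 < lam) (hβ : 0 < β) :
    HasExponentRate (fun x => lam * x / Real.log x ^ β) (fun y => Real.log y ^ β) := by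
  refine .of_tendsto (G' := fun x => lam * (1 - β / Real.log x) / Real.log x ^ β) (θ := 1 / 2)
    (tendsto_mul_div_log_rpow_atTop hlam β)
    ((tendsto_rpow_atTop hβ).comp Real.tendsto_log_atTop) (by norm_num) (by norm_num)
    (hasPotterBound_log_rpow hβ (by norm_num)) ?_ hlam ?_
  · filter_upwards [eventually_gt_atTop 1] with x hx using hasDerivAt_mul_div_log_rpow hx
  · have hratio := (tendsto_log_mul_div_log_rpow_div_log hlam β).rpow_const (p := β)
      (Or.inl one_ne_zero)
    have hlim := hratio.mul (((Real.tendsto_log_atTop.const_div_atTop β).const_sub 1).const_mul lam)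
    rw [Real.one_rpow, sub_zero, mul_one, one_mul] at hlim
    refine hlim.congr' ?_
    filter_upwards [eventually_gt_atTop 1,
      (tendsto_mul_div_log_rpow_atTop hlam β).eventually_gt_atTop 1] with x hx hG
    rw [Real.div_rpow (Real.log_pos hG).le (Real.log_pos hx).le]
    ring

theorem HasPowerTail.exists_tailProportional {p : ℕ+ → ℝ} {lam : ℝ} (h : HasPowerTail p lam) :
    ∃ k₀, TailProportional p (fun x => Real.exp (-(lam * Real.log x))) k₀ := by
  obtain ⟨k₀, c, hc, hpc⟩ := h
  refine ⟨k₀, c, hc, fun k hk => ?_⟩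
  have hk0 : (0 : ℝ) < (k : ℕ) := by exact_mod_cast k.pos
  simp only [hpc k hk, Real.exp_neg, mul_comm lam, ← Real.rpow_def_of_pos hk0, one_div]

theorem eventually_exp_mul_log_eq_rpow (s : ℝ) :
    (fun v : ℕ => Real.exp (s * Real.log v)) =ᶠ[atTop] fun v => (v : ℝ) ^ s := by
  filter_upwards [eventually_gt_atTop 0] with v hv
  rw [mul_comm, Real.rpow_def_of_pos (by exact_mod_cast hv)]

theorem proposition2 (p : ℕ+ → ℝ) (hp : IsProbDist p) :
    (∀ lam : ℝ, 1 < lam → HasPowerTail p lam →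
      Tendsto (tailIndex p) atTop atTop ∧
      SameRate (tailIndex p) (fun v => (v : ℝ) ^ (1 / lam))) ∧
    (∀ lam α : ℝ, 0 < lam → 0 < α → α < 1 → HasSubexpTail p lam α →
      Tendsto (tailIndex p) atTop atTop ∧
      SameRate (tailIndex p) (fun v => Real.log (v : ℝ) ^ (1 / α - 1))) ∧
    (∀ lam β : ℝ, 0 < lam → 0 < β → HasNearExpTail p lam β →
      Tendsto (tailIndex p) atTop atTop ∧
      SameRate (tailIndex p) (fun v => Real.log (Real.log (v : ℝ)) ^ β)) := by
  refine ⟨fun lam hlam hpower => ?_, fun lam α hlam hα0 hα1 ⟨_, htail⟩ => ?_,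
    fun lam β hlam hβ ⟨_, _, htail⟩ => ?_⟩
  · obtain ⟨_, htail⟩ := hpower.exists_tailProportional
    have hrate := hasExponentRate_mul_log hlam
    exact ⟨tendsto_tailIndex_atTop hp htail hrate,
      (sameRate_tailIndex hp htail hrate).congr_right (eventually_exp_mul_log_eq_rpow (1 / lam))⟩
  · have hrate := hasExponentRate_mul_rpow hlam hα0 hα1
    exact ⟨tendsto_tailIndex_atTop hp htail hrate, sameRate_tailIndex hp htail hrate⟩
  · have hrate := hasExponentRate_mul_div_log_rpow hlam hβ
    exact ⟨tendsto_tailIndex_atTop hp htail hrate, sameRate_tailIndex hp htail hrate⟩
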